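/- Consider $K$ users, a library of $N$ files, and a cache of size $M>0$ files at each user; put $L=\lceil N/M\rceil$. Every file is divided into $F=LF'$ packets, arranged in $F'$ groups of $L$ packets each. *Placement.* For every user, every file and every group, independently, the user stores one packet of that group of that file, chosen uniformly at random. Let $S_{n,f}\subseteq\{1,\dots,K\}$ be the set of users that store packet $f$ of file $n$. *Delivery* (with parameter $g$, for demands $\mathbf d=(d_1,\dots,d_K)\in\{1,\dots,N\}^K$, not necessarily distinct). First (pull-down), for every packet $f$ of every requested file $n$ with $|S_{n,f}|\ge g+1$, independently, replace $S_{n,f}$ by a uniformly random $g$-element subset of itself. Then run the following greedy scheme with the new sets $S_{n,f}$: start with $C=\emptyset$ and go through all pairs $(k,f)$, where $1\le k\le K$ and $f$ is a packet label. If $k\in S_{d_k,f}$ or $(k,f)\in C$, do nothing. Otherwise, for every $j\in S_{d_k,f}$ for which there is a packet label $f'$ with $(j,f')\notin C$ and $S_{d_j,f'}=(S_{d_k,f}\cup\{k\})\setminus\{j\}$, select one such pair $(j,f')$ (the first one, say); let $A$ be the set of the selected pairs, transmit the XOR of packet $f$ of file $d_k$ and of the packets $f'$ of the files $d_j$, $(j,f')\in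 A$, and add $(k,f)$ and the elements of $A$ to $C$. The rate $R(\mathbf d)$ is the number of transmissions divided by $F$. **Theorem.** For every constant $c>0$ there is a function $\varepsilon:\mathbb N\to\mathbb R$ with $\varepsilon(K)\to0$ as $K\to\infty$ such that the following holds for all $K,N,g\in\mathbb N$ and real $M>0$ with $$N>K,\qquad 2\le g\le\frac{K}{3\lceil N/M\rceil},\qquad \lceil N/M\rceil\le\frac{K}{\frac{27}{4}\log K}.$$ For every integer $F'\ge c\binom Kg\bigl(\log\binom Kg\bigr)^2$ and every demand vector $\mathbf d$, $$\mathbb E\,[R(\mathbf d)]\le\frac43\,\frac{K}{g+1}\,\bigl(1+\varepsilon(K)\bigr),$$ where the expectation is over the randomness of both placement and delivery. Moreover, there is such an $F'\geq 1$ for which the number of packets per file satisfies $$F=\lceil N/M\rceil F'\le(c+1)\binom Kg\Bigl(\log\binom Kg\Bigr)^2\lceil N/M\rceil ,$$ so that $F=O\bigl(\binom Kg(\log\binom Kg)^2\lceil N/M\rceil\bigr)$ packets per file suffice. -/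

import Mathlib

open scoped BigOperators

namespace CodedCaching

/-- The number `⌈N/M⌉` of packets in a group, for `N` files and caches of size `M` files. -/
noncomputable def groupSize (N : ℕ) (M : ℝ) : ℕ := ⌈(N : ℝ) / M⌉₊

/-- A cache configuration: for every file `n` and every packet `f` the set `S n f` of users in whose
cache packet `f` of file `n` is stored. `P` is the set of packet labels of a file. -/
abbrev Config (K N : ℕ) (P : Type) := Fin N → P → Finset (Fin K)

/-- Packet labels when a file is divided into `F'` groups of `L` packets: (group, position).
A file has `F = L * F'` packets. -/
abbrev Packet (F' L : ℕ) := Fin F' × Fin L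

/-- All packet labels, in lexicographic order. -/
def packetList (F' L : ℕ) : List (Packet F' L) := List.finRange F' ×ˢ List.finRange L

/-- An outcome of the random placement: `ω k n f'` is the position of the packet of group `f'` of
file `n` that user `k` caches. All the choices are independent and uniform, so the random placement
is a uniformly random element of this finite type. -/
abbrev Placement (K N F' L : ℕ) := Fin K → Fin N → Fin F' → Fin L

/-- The cache configuration that results from a placement. -/
def Placement.config {K N F' L : ℕ} (ω : Placement K N F' L) : Config K N (Packet F' L) :=
  fun n p => Finset.univ.filter fun k => ω k n p.1 = p.2

section Delivery

variable {K N : ℕ} {P : Type} [DecidableEq P]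

/-- A node `(k, f)` stands for the packet `f` of the file `d k` requested by user `k`.
`partners packets S d C (k, f)` is the set `A` built in one iteration of the delivery: for every
user `j ∈ S (d k) f` it holds the first node `(j, f')` (if there is one) that is not yet covered
(not in `C`) and has `S (d j) f' = S (d k) f ∪ {k} - {j}`. -/
def partners (packets : List P) (S : Config K N P) (d : Fin K → Fin N)
    (C : Finset (Fin K × P)) (v : Fin K × P) : Finset (Fin K × P) :=
  (S (d v.1) v.2).biUnion fun j =>
    ((packets.find? fun f' =>
      decide ((j, f') ∉ C ∧ S (d j) f' = (insert v.1 (S (d v.1) v.2)).erase j)).map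
        fun f' => (j, f')).toFinset

/-- One iteration of the delivery. The state consists of the set `C` of covered nodes and the list of
transmissions made so far; a transmission is the XOR of the packets of a set of nodes. Nothing is
done if user `k` holds the packet or if the node is already covered. -/
def deliveryStep (packets : List P) (S : Config K N P) (d : Fin K → Fin N)
    (st : Finset (Fin K × P) × List (Finset (Fin K × P))) (v : Fin K × P) :
    Finset (Fin K × P) × List (Finset (Fin K × P)) :=
  if v.1 ∈ S (d v.1) v.2 ∨ v ∈ st.1 then st
  else
    (insert v (st.1 ∪ partners packets S d st.1 v),
      insert v (partners packets S d st.1 v) :: st.2)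

/-- The list of all transmissions made by the greedy clique cover delivery (NewDelivery) for the
configuration `S` and the demands `d`, running through all nodes `(k, f)` in lexicographic order. -/
def newDelivery (packets : List P) (S : Config K N P) (d : Fin K → Fin N) :
    List (Finset (Fin K × P)) :=
  ((List.finRange K ×ˢ packets).foldl (deliveryStep packets S d) (∅, [])).2

/-- The normalized number of transmissions of NewDelivery: the number of transmitted packets divided
by the number of packets of a file. -/
noncomputable def rateND (packets : List P) (S : Config K N P) (d : Fin K → Fin N) : ℝ :=
  ((newDelivery packets S d).length : ℝ) / (packets.length : ℝ)

/-- The possible results of the pull-down phase with parameter `g`: for every packet of a requested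
file that is stored in at least `g + 1` caches, `S n f` is replaced by one of its `g`-subsets;
all other `S n f` are kept. Since this is a product set, an independent and uniform choice of a
`g`-subset for every such packet is the same as a uniform choice from this set. -/
def pullDowns [Fintype P] (g : ℕ) (S : Config K N P) (d : Fin K → Fin N) :
    Finset (Config K N P) :=
  Fintype.piFinset fun n => Fintype.piFinset fun f =>
    if (∃ k, d k = n) ∧ g + 1 ≤ (S n f).card then (S n f).powersetCard g else {S n f}

/-- The expected rate of ModifiedDelivery (a random pull-down followed by NewDelivery on the resulting
virtual configuration), for a fixed cache configuration `S` and demands `d`. -/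
noncomputable def expectedRateMD [Fintype P] (packets : List P) (g : ℕ) (S : Config K N P)
    (d : Fin K → Fin N) : ℝ :=
  Finset.expect (pullDowns g S d) fun S' => rateND packets S' d

end Delivery

/-- The expected rate, over the random placement and the random pull-down, for files that consist of
`F'` groups of `L` packets. -/
noncomputable def expectedRate {K N : ℕ} (F' L g : ℕ) (d : Fin K → Fin N) : ℝ :=
  Finset.expect (Finset.univ : Finset (Placement K N F' L)) fun ω =>
    expectedRateMD (packetList F' L) g ω.config d

end CodedCaching

/-! The greedy cover is analysed with a potential. A node `(k, f)` belongs to the user set `U =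
insert k (S (d k) f)`, and every transmission serves nodes of a single `U`, one from each user of
`U` that still has an uncovered node there. So each transmission lowers by one the largest number of
uncovered nodes that a user has in `U`, and the total is at most the sum over `U` of `max_{j ∈ U}
countCached S (d j) (U.erase j)` (`potential_step`, `length_newDelivery_le_sum_sup`).

After the pull-down no relevant set has more than `g` users. Sets `U` of size `g + 1` give the main
term; the rest costs at most the number of nodes whose packet lies in fewer than `g` caches, which
is exponentially rare (`packetExpect_card_lt_le`, `tail_le`).

For the main term, symmetry among users bounds each mean count by `m = F' * L / K.choose g`
(`hitProb_le`). Independence of groups and disjointness of caches within a group bound the variance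
by the mean. The maximum is then controlled by the sum of squared deviations (`cast_sup_le`), so
repeated demands do no harm: no independence between users' files is needed. Since `(g + 1) *
K.choose (g + 1) ≤ K * K.choose g`, the main term contributes `5/4 * K / (g + 1)` to the rate and
the rare packets `1/12 * K / (g + 1)`, which add up to `4/3`. For large `K` no error term is left;
small `K` is absorbed by `ε`. -/

namespace CodedCaching

/-! ### Deterministic bound on the greedy cover -/

section Greedy

variable {K N : ℕ} {P : Type} [DecidableEq P] [Fintype P]

/-- The uncovered packets `f` for which the node `(j, f)` belongs to the user set `U`. -/
def uncovered (S : Config K N P) (d : Fin K → Fin N) (C : Finset (Fin K × P))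
    (U : Finset (Fin K)) (j : Fin K) : Finset P :=
  Finset.univ.filter fun f => (j, f) ∉ C ∧ S (d j) f = U.erase j

/-- The number of transmissions that suffice for the nodes not covered by `C`. -/
def potential (S : Config K N P) (d : Fin K → Fin N) (C : Finset (Fin K × P)) : ℕ :=
  ∑ U : Finset (Fin K), U.sup fun j => (uncovered S d C U j).card

/-- The number of packets of file `n` cached by exactly the users in `W`. -/
def countCached (S : Config K N P) (n : Fin N) (W : Finset (Fin K)) : ℕ :=
  (Finset.univ.filter fun f => S n f = W).card

lemma uncovered_mono (S : Config K N P) (d : Fin K → Fin N) {C C' : Finset (Fin K × P)}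
    (h : C ⊆ C') (U : Finset (Fin K)) (j : Fin K) :
    uncovered S d C' U j ⊆ uncovered S d C U j := by
  intro f hf
  simp only [uncovered, Finset.mem_filter, Finset.mem_univ, true_and] at hf ⊢
  exact ⟨fun hc => hf.1 (h hc), hf.2⟩

lemma exists_partner (packets : List P) (hp : ∀ f, f ∈ packets) (S : Config K N P)
    (d : Fin K → Fin N) (C : Finset (Fin K × P)) (v : Fin K × P) {j : Fin K}
    (hj : j ∈ S (d v.1) v.2)
    (hne : (uncovered S d C (insert v.1 (S (d v.1) v.2)) j).Nonempty) :
    ∃ f ∈ uncovered S d C (insert v.1 (S (d v.1) v.2)) j,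
      (j, f) ∈ partners packets S d C v := by
  obtain ⟨f₀, hf₀⟩ := hne
  simp only [uncovered, Finset.mem_filter, Finset.mem_univ, true_and] at hf₀ ⊢
  cases hfind : packets.find? fun f' =>
      decide ((j, f') ∉ C ∧ S (d j) f' = (insert v.1 (S (d v.1) v.2)).erase j) with
  | none =>
    have := List.find?_eq_none.1 hfind f₀ (hp f₀)
    exact absurd (decide_eq_true hf₀) this
  | some f =>
    have hf := List.find?_some hfind
    refine ⟨f, of_decide_eq_true hf, ?_⟩
    rw [partners, Finset.mem_biUnion]
    exact ⟨j, hj, by rw [hfind]; simp⟩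

/-- Only the term of `U₀`, the user set of `v`, has to drop: each user of `U₀` with uncovered nodes
there loses one, either `v` itself or its selected partner. All other terms can only decrease
because `C` grows. -/
lemma potential_step (packets : List P) (hp : ∀ f, f ∈ packets) (S : Config K N P)
    (d : Fin K → Fin N) (C : Finset (Fin K × P)) (v : Fin K × P)
    (hv : v.1 ∉ S (d v.1) v.2) (hC : v ∉ C) :
    potential S d (insert v (C ∪ partners packets S d C v)) + 1 ≤ potential S d C := by
  set C' := insert v (C ∪ partners packets S d C v) with hC'
  have hsub : C ⊆ C' := fun x hx => by simp [hC', hx]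
  set U₀ := insert v.1 (S (d v.1) v.2) with hU₀
  have hv0 : v.2 ∈ uncovered S d C U₀ v.1 := by
    simp [uncovered, hC, hU₀, Finset.erase_insert hv]
  have hlt : ∀ j ∈ U₀, (uncovered S d C' U₀ j).card ≤ (uncovered S d C U₀ j).card - 1 := by
    intro j hj
    rcases (uncovered S d C U₀ j).eq_empty_or_nonempty with he | hne
    · have := Finset.card_le_card (uncovered_mono S d hsub U₀ j)
      rw [he] at this ⊢
      simpa using this
    · have key : ∃ f ∈ uncovered S d C U₀ j, (j, f) ∈ C' := by
        rcases Finset.mem_insert.1 hj with rfl | hj'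
        · exact ⟨v.2, hv0, by simp [hC']⟩
        · obtain ⟨f, hf, hfp⟩ := exists_partner packets hp S d C v hj' hne
          exact ⟨f, hf, by simp [hC', hfp]⟩
      obtain ⟨f, hf, hfC⟩ := key
      rw [← Finset.card_erase_of_mem hf]
      refine Finset.card_le_card fun x hx => Finset.mem_erase.2 ⟨?_, uncovered_mono S d hsub U₀ j hx⟩
      rintro rfl
      simp only [uncovered, Finset.mem_filter, Finset.mem_univ, true_and] at hx
      exact hx.1 hfC
  -- The subtraction in `hlt` is truncated; positivity of the maximum, witnessed by `v`, makes the
  -- decrease strict.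
  have hpos : 1 ≤ U₀.sup fun j => (uncovered S d C U₀ j).card :=
    le_trans (Finset.card_pos.2 ⟨_, hv0⟩ : 0 < (uncovered S d C U₀ v.1).card)
      (Finset.le_sup (f := fun j => (uncovered S d C U₀ j).card) (Finset.mem_insert_self _ _))
  have hU : (U₀.sup fun j => (uncovered S d C' U₀ j).card) + 1
      ≤ U₀.sup fun j => (uncovered S d C U₀ j).card := by
    have : (U₀.sup fun j => (uncovered S d C' U₀ j).card)
        ≤ (U₀.sup fun j => (uncovered S d C U₀ j).card) - 1 := by
      refine Finset.sup_le fun j hj => (hlt j hj).trans ?_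
      have := Finset.le_sup (f := fun j => (uncovered S d C U₀ j).card) hj
      exact Nat.sub_le_sub_right this 1
    omega
  rw [potential, potential, ← Finset.add_sum_erase _ _ (Finset.mem_univ U₀),
    ← Finset.add_sum_erase (Finset.univ) (fun U : Finset (Fin K) =>
      U.sup fun j => (uncovered S d C U j).card) (Finset.mem_univ U₀)]
  have hrest : ∑ U ∈ Finset.univ.erase U₀, (U.sup fun j => (uncovered S d C' U j).card)
      ≤ ∑ U ∈ Finset.univ.erase U₀, (U.sup fun j => (uncovered S d C U j).card) :=
    Finset.sum_le_sum fun U _ => Finset.sup_mono_fun fun j _ =>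
      Finset.card_le_card (uncovered_mono S d hsub U j)
  omega

lemma length_foldl_deliveryStep_le (packets : List P) (hp : ∀ f, f ∈ packets)
    (S : Config K N P) (d : Fin K → Fin N) (l : List (Fin K × P))
    (st : Finset (Fin K × P) × List (Finset (Fin K × P))) :
    (l.foldl (deliveryStep packets S d) st).2.length ≤ st.2.length + potential S d st.1 := by
  induction l generalizing st with
  | nil => simp
  | cons v l ih =>
    rw [List.foldl_cons]
    refine (ih _).trans ?_
    unfold deliveryStep
    split_ifs with h
    · exact le_rfl
    · push Not at h
      have := potential_step packets hp S d st.1 v h.1 h.2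
      simp only [List.length_cons]
      omega

lemma length_newDelivery_le_sum_sup (packets : List P) (hp : ∀ f, f ∈ packets)
    (S : Config K N P) (d : Fin K → Fin N) :
    (newDelivery packets S d).length
      ≤ ∑ U : Finset (Fin K), U.sup fun j => countCached S (d j) (U.erase j) := by
  refine (length_foldl_deliveryStep_le packets hp S d _ _).trans ?_
  simp [potential, uncovered, countCached]

/-- Transmissions to `g + 1` users are bounded by the largest class, all others by the number of
nodes whose packet is cached by fewer than `g` users. -/
lemma length_newDelivery_le (packets : List P) (hp : ∀ f, f ∈ packets)
    (S : Config K N P) (d : Fin K → Fin N) (g : ℕ) (hS : ∀ k f, (S (d k) f).card ≤ g) :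
    (newDelivery packets S d).length
      ≤ (∑ U ∈ Finset.univ.powersetCard (g + 1),
          U.sup fun j => countCached S (d j) (U.erase j))
        + ∑ j : Fin K, (Finset.univ.filter fun f => (S (d j) f).card < g).card := by
  refine (length_newDelivery_le_sum_sup packets hp S d).trans ?_
  rw [← Finset.sum_filter_add_sum_filter_not Finset.univ (fun U : Finset (Fin K) => U.card = g + 1)]
  refine Nat.add_le_add (Finset.sum_le_sum_of_subset fun U hU => ?_) ?_
  · simpa [Finset.mem_powersetCard] using hU
  · calc _ ≤ ∑ U ∈ Finset.univ.filter (fun U : Finset (Fin K) => ¬ U.card = g + 1),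
            ∑ j ∈ U, countCached S (d j) (U.erase j) :=
          Finset.sum_le_sum fun U _ => Finset.sup_le fun j hj =>
            Finset.single_le_sum (f := fun j => countCached S (d j) (U.erase j))
              (fun _ _ => Nat.zero_le _) hj
      _ = ∑ j : Fin K, ∑ U : Finset (Fin K), if ¬ U.card = g + 1 ∧ j ∈ U then
            countCached S (d j) (U.erase j) else 0 := by
          rw [Finset.sum_comm, Finset.sum_filter]
          refine Finset.sum_congr rfl fun U _ => ?_
          by_cases h : U.card = g + 1 <;> simp [h, Finset.sum_ite_mem]
      _ ≤ _ := by
          refine Finset.sum_le_sum fun j _ => ?_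
          calc _ = ∑ U : Finset (Fin K), ∑ f : P,
                if (¬ U.card = g + 1 ∧ j ∈ U) ∧ S (d j) f = U.erase j then 1 else 0 := by
                refine Finset.sum_congr rfl fun U _ => ?_
                by_cases h : ¬ U.card = g + 1 ∧ j ∈ U
                · simp [h, countCached]
                · simp [h]
            _ ≤ ∑ f : P, if (S (d j) f).card < g then 1 else 0 := by
                rw [Finset.sum_comm]
                refine Finset.sum_le_sum fun f _ => ?_
                rw [← Finset.card_filter]
                split_ifs with hlt
                -- Given `j` and `f`, the set `U` is recovered as `insert j (S (d j) f)`, so each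
                -- node is counted at most once.
                · refine Finset.card_le_one.2 fun U hU V hV => ?_
                  simp only [Finset.mem_filter, Finset.mem_univ, true_and] at hU hV
                  rw [← Finset.insert_erase hU.1.2, ← Finset.insert_erase hV.1.2, ← hU.2, ← hV.2]
                · rw [Nat.le_zero, Finset.card_eq_zero, Finset.filter_eq_empty_iff]
                  rintro U - ⟨⟨h1, h2⟩, h3⟩
                  have h4 := hS j f
                  have h5 := Finset.card_erase_add_one h2
                  rw [← h3] at h5
                  omega
            _ = _ := by rw [Finset.card_filter]

end Greedy

lemma length_newDelivery_le_card {K N : ℕ} {P : Type} [DecidableEq P]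
    (packets : List P) (S : Config K N P) (d : Fin K → Fin N) :
    (newDelivery packets S d).length ≤ K * packets.length := by
  have key : ∀ (l : List (Fin K × P)) (st : Finset (Fin K × P) × List (Finset (Fin K × P))),
      (l.foldl (deliveryStep packets S d) st).2.length ≤ st.2.length + l.length := by
    intro l
    induction l with
    | nil => simp
    | cons v l ih =>
      intro st
      rw [List.foldl_cons]
      refine (ih _).trans ?_
      unfold deliveryStep
      split_ifs <;> simp only [List.length_cons] <;> omega
  refine (key _ _).trans ?_
  simp [List.length_product]

/-! ### Uniform averages over product sets -/

section Product

variable {ι : Type*} [Fintype ι] [DecidableEq ι] {κ : ι → Type*} (t : ∀ i, Finset (κ i))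

lemma expect_piFinset_prod (f : ∀ i, κ i → ℝ) :
    Finset.expect (Fintype.piFinset t) (fun x => ∏ i, f i (x i))
      = ∏ i, Finset.expect (t i) (f i) := by
  simp only [Finset.expect_eq_sum_div_card, Fintype.card_piFinset, Finset.prod_div_distrib,
    Finset.prod_univ_sum, Nat.cast_prod]

/-- The product formula with the constant `1` at all other coordinates; nonemptiness makes those
factors equal to `1`. -/
lemma expect_piFinset_apply (ht : ∀ i, (t i).Nonempty) (i : ι) (f : κ i → ℝ) :
    Finset.expect (Fintype.piFinset t) (fun x => f (x i)) = Finset.expect (t i) f := by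
  have h := expect_piFinset_prod t (Function.update (fun _ _ => (1 : ℝ)) i f)
  rw [Finset.prod_eq_single i (fun j _ hj => by simp [Function.update_of_ne hj, ht j]) (by simp)] at h
  rw [Function.update_self] at h
  rw [← h]
  refine Finset.expect_congr rfl fun x _ => ?_
  rw [Finset.prod_eq_single i (fun j _ hj => by simp [Function.update_of_ne hj]) (by simp)]
  simp

lemma expect_piFinset_apply_mul_apply (ht : ∀ i, (t i).Nonempty) {i j : ι} (hij : i ≠ j)
    (f : κ i → ℝ) (h : κ j → ℝ) :
    Finset.expect (Fintype.piFinset t) (fun x => f (x i) * h (x j))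
      = Finset.expect (t i) f * Finset.expect (t j) h := by
  have key := expect_piFinset_prod t
    (Function.update (Function.update (fun _ _ => (1 : ℝ)) j h) i f)
  rw [Finset.prod_eq_mul i j hij
    (fun l _ hl => by simp [Function.update_of_ne hl.1, Function.update_of_ne hl.2, ht l])
    (by simp) (by simp)] at key
  rw [Function.update_self, Function.update_of_ne hij.symm, Function.update_self] at key
  rw [← key]
  refine Finset.expect_congr rfl fun x _ => ?_
  rw [Finset.prod_eq_mul i j hij
    (fun l _ hl => by simp [Function.update_of_ne hl.1, Function.update_of_ne hl.2])
    (by simp) (by simp)]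
  simp [Function.update_of_ne hij.symm]

end Product

/-! ### Pull-down of a single packet and its independence across packets -/

/-- The possible results of the pull-down of one packet stored by the users in `A`. -/
def pulled {K : ℕ} (g : ℕ) (A : Finset (Fin K)) : Finset (Finset (Fin K)) :=
  if g + 1 ≤ A.card then A.powersetCard g else {A}

/-- The users that choose position `l` in a group, where user `k` chooses `w k`. -/
def holders {K L : ℕ} (w : Fin K → Fin L) (l : Fin L) : Finset (Fin K) :=
  Finset.univ.filter fun k => w k = l

lemma pulled_nonempty {K : ℕ} (g : ℕ) (A : Finset (Fin K)) : (pulled g A).Nonempty := by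
  unfold pulled
  split_ifs with h
  · exact Finset.powersetCard_nonempty.2 (by omega)
  · simp

lemma subset_of_mem_pulled {K g : ℕ} {A B : Finset (Fin K)} (h : B ∈ pulled g A) : B ⊆ A := by
  unfold pulled at h
  split_ifs at h
  · exact (Finset.mem_powersetCard.1 h).1
  · exact (Finset.mem_singleton.1 h).subset

lemma card_le_of_mem_pulled {K g : ℕ} {A B : Finset (Fin K)} (h : B ∈ pulled g A) :
    B.card ≤ g := by
  unfold pulled at h
  split_ifs at h with hc
  · exact (Finset.mem_powersetCard.1 h).2.le
  · rw [Finset.mem_singleton.1 h]; omega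

lemma card_lt_of_mem_pulled {K g : ℕ} {A B : Finset (Fin K)} (h : B ∈ pulled g A)
    (hB : B.card < g) : A.card < g := by
  unfold pulled at h
  split_ifs at h with hc
  · exact absurd (Finset.mem_powersetCard.1 h).2 hB.ne
  · rwa [← Finset.mem_singleton.1 h]

lemma pullDowns_apply_nonempty {K N : ℕ} {P : Type} (g : ℕ) (S : Config K N P)
    (d : Fin K → Fin N) (n : Fin N) (f : P) :
    (if (∃ k, d k = n) ∧ g + 1 ≤ (S n f).card then (S n f).powersetCard g
      else {S n f}).Nonempty := by
  split_ifs with h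
  · exact Finset.powersetCard_nonempty.2 (by omega)
  · simp

lemma pullDowns_apply_requested {K N : ℕ} {P : Type} (g : ℕ) (S : Config K N P)
    (d : Fin K → Fin N) (k : Fin K) (f : P) :
    (if (∃ j, d j = d k) ∧ g + 1 ≤ (S (d k) f).card then (S (d k) f).powersetCard g
      else {S (d k) f}) = pulled g (S (d k) f) := by
  simp [pulled, show ∃ j, d j = d k from ⟨k, rfl⟩]

section PullDowns

variable {K N : ℕ} {P : Type} [DecidableEq P] [Fintype P]

lemma pullDowns_nonempty (g : ℕ) (S : Config K N P) (d : Fin K → Fin N) :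
    (pullDowns g S d).Nonempty :=
  Fintype.piFinset_nonempty.2 fun n => Fintype.piFinset_nonempty.2 fun f =>
    pullDowns_apply_nonempty g S d n f

lemma mem_pulled_of_mem_pullDowns {g : ℕ} {S S' : Config K N P} {d : Fin K → Fin N}
    (h : S' ∈ pullDowns g S d) (k : Fin K) (f : P) : S' (d k) f ∈ pulled g (S (d k) f) := by
  have := Fintype.mem_piFinset.1 (Fintype.mem_piFinset.1 h (d k)) f
  rwa [pullDowns_apply_requested] at this

lemma expect_pullDowns_apply (g : ℕ) (S : Config K N P) (d : Fin K → Fin N) (k : Fin K) (f : P)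
    (h : Finset (Fin K) → ℝ) :
    Finset.expect (pullDowns g S d) (fun S' => h (S' (d k) f))
      = Finset.expect (pulled g (S (d k) f)) h := by
  unfold pullDowns
  rw [expect_piFinset_apply _ (fun n => Fintype.piFinset_nonempty.2 fun f =>
    pullDowns_apply_nonempty g S d n f) (d k) (fun y => h (y f)),
    expect_piFinset_apply _ (fun f => pullDowns_apply_nonempty g S d (d k) f) f h,
    pullDowns_apply_requested]

lemma expect_pullDowns_apply_mul_apply (g : ℕ) (S : Config K N P) (d : Fin K → Fin N) (k : Fin K)
    {f f' : P} (hf : f ≠ f') (h h' : Finset (Fin K) → ℝ) :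
    Finset.expect (pullDowns g S d) (fun S' => h (S' (d k) f) * h' (S' (d k) f'))
      = Finset.expect (pulled g (S (d k) f)) h * Finset.expect (pulled g (S (d k) f')) h' := by
  unfold pullDowns
  rw [expect_piFinset_apply _ (fun n => Fintype.piFinset_nonempty.2 fun f =>
    pullDowns_apply_nonempty g S d n f) (d k) (fun y => h (y f) * h' (y f')),
    expect_piFinset_apply_mul_apply _ (fun f => pullDowns_apply_nonempty g S d (d k) f) hf h h',
    pullDowns_apply_requested, pullDowns_apply_requested]

end PullDowns

/-! ### Joint expectation over placement and pull-down -/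

section Placement

variable {F' K N L : ℕ}

/-- A placement as an independent choice for every group of every file. -/
def placementEquiv (K N F' L : ℕ) : Placement K N F' L ≃ (Fin N × Fin F' → Fin K → Fin L) where
  toFun ω := fun x k => ω k x.1 x.2
  invFun w := fun k n i => w (n, i) k
  left_inv _ := rfl
  right_inv _ := rfl

lemma expect_placement_group [NeZero L] (n : Fin N) (i : Fin F') (h : (Fin K → Fin L) → ℝ) :
    Finset.expect (Finset.univ : Finset (Placement K N F' L)) (fun ω => h fun k => ω k n i)
      = Finset.expect Finset.univ h := by
  refine (Finset.expect_equiv (placementEquiv K N F' L) (s := Finset.univ) (t := Finset.univ)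
    (g := fun w => h (w (n, i))) (by simp) (fun _ _ => rfl)).trans ?_
  rw [← Fintype.piFinset_univ]
  exact expect_piFinset_apply (κ := fun _ => Fin K → Fin L) (fun _ : Fin N × Fin F' => Finset.univ)
    (fun _ => Finset.univ_nonempty) (n, i) h

lemma expect_placement_group_mul_group [NeZero L] (n : Fin N) {i i' : Fin F'} (hi : i ≠ i')
    (φ ψ : (Fin K → Fin L) → ℝ) :
    Finset.expect (Finset.univ : Finset (Placement K N F' L))
        (fun ω => (φ fun k => ω k n i) * (ψ fun k => ω k n i'))
      = Finset.expect Finset.univ φ * Finset.expect Finset.univ ψ := by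
  refine (Finset.expect_equiv (placementEquiv K N F' L) (s := Finset.univ) (t := Finset.univ)
    (g := fun w => φ (w (n, i)) * ψ (w (n, i'))) (by simp) (fun _ _ => rfl)).trans ?_
  rw [← Fintype.piFinset_univ]
  exact expect_piFinset_apply_mul_apply (κ := fun _ => Fin K → Fin L)
    (fun _ : Fin N × Fin F' => Finset.univ)
    (fun _ => Finset.univ_nonempty) (i := (n, i)) (j := (n, i')) (by simpa using hi) φ ψ

/-- Expectation over the random placement and the random pull-down. -/
noncomputable def mdExpect (g : ℕ) (d : Fin K → Fin N) (φ : Config K N (Packet F' L) → ℝ) : ℝ :=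
  Finset.expect (Finset.univ : Finset (Placement K N F' L)) fun ω =>
    Finset.expect (pullDowns g ω.config d) φ

lemma mdExpect_mono (g : ℕ) (d : Fin K → Fin N) {φ ψ : Config K N (Packet F' L) → ℝ}
    (h : ∀ ω : Placement K N F' L, ∀ S ∈ pullDowns g ω.config d, φ S ≤ ψ S) :
    mdExpect g d φ ≤ mdExpect g d ψ :=
  Finset.expect_le_expect fun ω _ => Finset.expect_le_expect fun S hS => h ω S hS

lemma mdExpect_add (g : ℕ) (d : Fin K → Fin N) (φ ψ : Config K N (Packet F' L) → ℝ) :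
    mdExpect g d (fun S => φ S + ψ S) = mdExpect g d φ + mdExpect g d ψ := by
  simp [mdExpect, Finset.expect_add_distrib]

lemma mdExpect_const_mul (g : ℕ) (d : Fin K → Fin N) (a : ℝ)
    (φ : Config K N (Packet F' L) → ℝ) :
    mdExpect g d (fun S => a * φ S) = a * mdExpect g d φ := by
  simp [mdExpect, Finset.mul_expect]

lemma mdExpect_sum {α : Type*} (g : ℕ) (d : Fin K → Fin N) (s : Finset α)
    (φ : α → Config K N (Packet F' L) → ℝ) :
    mdExpect g d (fun S => ∑ a ∈ s, φ a S) = ∑ a ∈ s, mdExpect g d (φ a) := by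
  simp [mdExpect, Finset.expect_sum_comm]

lemma mdExpect_const [NeZero L] (g : ℕ) (d : Fin K → Fin N) (a : ℝ) :
    mdExpect g d (fun _ : Config K N (Packet F' L) => a) = a := by
  simp [mdExpect, pullDowns_nonempty]

/-- The expectation of `h` at the pulled-down user set of one packet. -/
noncomputable def packetExpect {K L : ℕ} (g : ℕ) (l : Fin L) (h : Finset (Fin K) → ℝ) : ℝ :=
  Finset.expect (Finset.univ : Finset (Fin K → Fin L)) fun w =>
    Finset.expect (pulled g (holders w l)) h

lemma mdExpect_apply [NeZero L] (g : ℕ) (d : Fin K → Fin N) (k : Fin K) (i : Fin F') (l : Fin L)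
    (h : Finset (Fin K) → ℝ) :
    mdExpect g d (fun S : Config K N (Packet F' L) => h (S (d k) (i, l))) = packetExpect g l h := by
  unfold mdExpect packetExpect
  simp only [expect_pullDowns_apply]
  exact expect_placement_group (d k) i fun w => Finset.expect (pulled g (holders w l)) h

lemma mdExpect_apply_mul_apply [NeZero L] (g : ℕ) (d : Fin K → Fin N) (k : Fin K) {i i' : Fin F'}
    (hi : i ≠ i') (l l' : Fin L) (h h' : Finset (Fin K) → ℝ) :
    mdExpect g d (fun S : Config K N (Packet F' L) => h (S (d k) (i, l)) * h' (S (d k) (i', l')))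
      = packetExpect g l h * packetExpect g l' h' := by
  unfold mdExpect packetExpect
  have hne : ∀ l l' : Fin L, (i, l) ≠ (i', l') := fun l l' e => hi (congrArg Prod.fst e)
  simp only [expect_pullDowns_apply_mul_apply g _ d k (hne l l')]
  exact expect_placement_group_mul_group (d k) hi
    (fun w => Finset.expect (pulled g (holders w l)) h)
    fun w => Finset.expect (pulled g (holders w l')) h'

end Placement

/-! ### Law of the user set of one packet -/

section SinglePacket

variable {K L : ℕ}

/-- The probability that a packet is stored, after the pull-down, by exactly the users in `W`. -/
noncomputable def hitProb (g : ℕ) (l : Fin L) (W : Finset (Fin K)) : ℝ :=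
  packetExpect g l fun A => if A = W then 1 else 0

lemma pulled_map (g : ℕ) (σ : Equiv.Perm (Fin K)) (A : Finset (Fin K)) :
    pulled g (A.map σ.toEmbedding) = (pulled g A).map (Finset.mapEmbedding σ.toEmbedding).toEmbedding := by
  unfold pulled
  rw [Finset.card_map]
  split_ifs
  · exact Finset.powersetCard_map _ _ _
  · simp

/-- Relabelling users preserves the uniform placement and commutes with the pull-down. -/
lemma hitProb_map (g : ℕ) (l : Fin L) (σ : Equiv.Perm (Fin K)) (W : Finset (Fin K)) :
    hitProb g l (W.map σ.toEmbedding) = hitProb g l W := by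
  unfold hitProb packetExpect
  symm
  refine Finset.expect_equiv (Equiv.arrowCongr σ (Equiv.refl _)) (by simp) fun w _ => ?_
  have hh : holders (Equiv.arrowCongr σ (Equiv.refl _) w) l = (holders w l).map σ.toEmbedding := by
    ext k
    simp [holders, Finset.mem_map_equiv]
  rw [hh, pulled_map]
  refine Finset.expect_bij (fun A _ => A.map σ.toEmbedding) (fun A hA => ?_) (fun A _ => ?_)
    (fun A _ B _ h => Finset.map_injective _ h) fun B hB => ?_
  · exact Finset.mem_map_of_mem (Finset.mapEmbedding σ.toEmbedding).toEmbedding hA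
  · simp [Finset.map_inj]
  · obtain ⟨A, hA, rfl⟩ := Finset.mem_map.1 hB
    exact ⟨A, hA, rfl⟩

lemma hitProb_eq_of_card_eq (g : ℕ) (l : Fin L) {W W' : Finset (Fin K)} (h : W.card = W'.card) :
    hitProb g l W = hitProb g l W' := by
  obtain ⟨σ, hσ⟩ : ∃ σ : Equiv.Perm (Fin K), W.map σ.toEmbedding = W' := by
    let e : {x // x ∈ W} ≃ {x // x ∈ W'} := Finset.equivOfCardEq h
    refine ⟨e.extendSubtype, ?_⟩
    refine Finset.eq_of_subset_of_card_le (fun x hx => ?_) (by simp [h])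
    obtain ⟨y, hy, rfl⟩ := Finset.mem_map.1 hx
    exact e.extendSubtype_mem y hy
  rw [← hσ, hitProb_map]

lemma sum_hitProb_le_one [NeZero L] (g : ℕ) (l : Fin L) (s : Finset (Finset (Fin K))) :
    ∑ W ∈ s, hitProb g l W ≤ 1 := by
  unfold hitProb packetExpect
  rw [← Finset.expect_sum_comm]
  refine Finset.expect_le Finset.univ_nonempty fun w _ => ?_
  rw [← Finset.expect_sum_comm]
  refine Finset.expect_le (pulled_nonempty _ _) fun A _ => ?_
  rw [Finset.sum_ite_eq]
  split_ifs <;> norm_num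

/-- The `K.choose g` sets of size `g` are hit with equal probability, and these events are disjoint.
-/
lemma hitProb_le [NeZero L] (g : ℕ) (l : Fin L) {W : Finset (Fin K)} (hW : W.card = g) :
    hitProb g l W ≤ 1 / (K.choose g : ℝ) := by
  have hK : 0 < K.choose g := Nat.choose_pos (by simpa [hW] using Finset.card_le_univ W)
  rw [le_div_iff₀ (by exact_mod_cast hK)]
  refine le_trans (le_of_eq ?_) (sum_hitProb_le_one (K := K) g l (Finset.univ.powersetCard g))
  rw [Finset.sum_congr rfl fun W' hW' =>
    hitProb_eq_of_card_eq g l ((Finset.mem_powersetCard.1 hW').2.trans hW.symm)]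
  simp [mul_comm]

/-- A packet is stored by fewer than `g` users with exponentially small probability. -/
lemma packetExpect_card_lt_le [NeZero L] (g : ℕ) (l : Fin L) :
    packetExpect (K := K) g l (fun A => if A.card < g then 1 else 0)
      ≤ 2 ^ g * (1 - 1 / (2 * (L : ℝ))) ^ K := by
  have hL : (L : ℝ) ≠ 0 := Nat.cast_ne_zero.2 (NeZero.ne L)
  -- Chernoff's method: the pulled set is smaller than `g` only if the original set was, so the
  -- indicator is at most `2 ^ g * (1 / 2) ^ (holders w l).card`, which factors over the independent
  -- users.
  calc _ ≤ Finset.expect (Finset.univ : Finset (Fin K → Fin L))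
        (fun w => 2 ^ g * ∏ k, if w k = l then (1 / 2 : ℝ) else 1) := by
        refine Finset.expect_le_expect fun w _ => Finset.expect_le (pulled_nonempty _ _) fun A hA => ?_
        have hp : ∏ k, (if w k = l then (1 / 2 : ℝ) else 1) = (1 / 2) ^ (holders w l).card := by
          rw [← Finset.prod_filter, Finset.prod_const]; rfl
        rw [hp]
        split_ifs with h
        · have h2 := card_lt_of_mem_pulled hA h
          rw [one_div, inv_pow, ← div_eq_mul_inv, one_le_div (by positivity)]
          exact pow_le_pow_right₀ (by norm_num) h2.le
        · positivity
    _ = _ := by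
        rw [← Finset.mul_expect, ← Fintype.piFinset_univ,
          expect_piFinset_prod (fun _ => Finset.univ) (fun _ a => if a = l then (1 / 2 : ℝ) else 1),
          Finset.prod_const, Finset.card_univ, Fintype.card_fin]
        congr 2
        have : ∀ a : Fin L, (if a = l then (1 / 2 : ℝ) else 1) = 1 - if a = l then 1 / 2 else 0 := by
          intro a; split_ifs <;> norm_num
        simp only [this, Finset.expect_eq_sum_div_card, Finset.sum_sub_distrib, Finset.sum_ite_eq']
        simp
        field_simp

end SinglePacket

/-! ### Mean and variance of the class sizes -/

section SecondMoment

variable {F' K N L : ℕ}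

/-- The number of packets in group `i` of file `n` that are cached by exactly the users in `W`. -/
noncomputable def groupCount (S : Config K N (Packet F' L)) (n : Fin N) (W : Finset (Fin K))
    (i : Fin F') : ℝ :=
  ∑ l : Fin L, if S n (i, l) = W then 1 else 0

/-- The expectation of `groupCount` for requested files. -/
noncomputable def groupMean (L g : ℕ) (W : Finset (Fin K)) : ℝ := ∑ l : Fin L, hitProb g l W

lemma groupMean_le [NeZero L] (g : ℕ) {W : Finset (Fin K)} (hW : W.card = g) :
    groupMean L g W ≤ L / (K.choose g : ℝ) := by
  refine (Finset.sum_le_sum fun l _ => hitProb_le g l hW).trans (le_of_eq ?_)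
  simp [div_eq_mul_inv]

lemma countCached_eq_sum_groupCount (S : Config K N (Packet F' L)) (n : Fin N)
    (W : Finset (Fin K)) : (countCached S n W : ℝ) = ∑ i, groupCount S n W i := by
  unfold countCached groupCount
  rw [Finset.card_filter, Nat.cast_sum, Fintype.sum_prod_type]
  simp only [Nat.cast_ite, Nat.cast_one, Nat.cast_zero]

/-- The caches of the packets of one group are disjoint. -/
lemma groupCount_le_one {g : ℕ} {d : Fin K → Fin N} {ω : Placement K N F' L}
    {S : Config K N (Packet F' L)} (hS : S ∈ pullDowns g ω.config d) (k : Fin K)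
    {W : Finset (Fin K)} (hW : W.Nonempty) (i : Fin F') : groupCount S (d k) W i ≤ 1 := by
  unfold groupCount
  rw [Finset.sum_boole]
  norm_cast
  refine Finset.card_le_one.2 fun l hl l' hl' => ?_
  simp only [Finset.mem_filter, Finset.mem_univ, true_and] at hl hl'
  obtain ⟨x, hx⟩ := hW
  have h1 : x ∈ ω.config (d k) (i, l) :=
    subset_of_mem_pulled (mem_pulled_of_mem_pullDowns hS k (i, l)) (hl ▸ hx)
  have h2 : x ∈ ω.config (d k) (i, l') :=
    subset_of_mem_pulled (mem_pulled_of_mem_pullDowns hS k (i, l')) (hl' ▸ hx)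
  simp only [Placement.config, Finset.mem_filter, Finset.mem_univ, true_and] at h1 h2
  exact h1.symm.trans h2

variable [NeZero L]

lemma mdExpect_groupCount (g : ℕ) (d : Fin K → Fin N) (k : Fin K) (W : Finset (Fin K))
    (i : Fin F') :
    mdExpect g d (fun S : Config K N (Packet F' L) => groupCount S (d k) W i) = groupMean L g W := by
  unfold groupCount groupMean
  rw [mdExpect_sum]
  exact Finset.sum_congr rfl fun l _ =>
    mdExpect_apply g d k i l (fun A => if A = W then 1 else 0)

lemma mdExpect_groupCount_mul_groupCount (g : ℕ) (d : Fin K → Fin N) (k : Fin K)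
    (W : Finset (Fin K)) {i i' : Fin F'} (hi : i ≠ i') :
    mdExpect g d (fun S : Config K N (Packet F' L) =>
      groupCount S (d k) W i * groupCount S (d k) W i') = groupMean L g W * groupMean L g W := by
  unfold groupCount groupMean
  simp only [Finset.sum_mul_sum, mdExpect_sum]
  exact Finset.sum_congr rfl fun l _ => Finset.sum_congr rfl fun l' _ =>
    mdExpect_apply_mul_apply g d k hi l l' (fun A => if A = W then 1 else 0)
      (fun A => if A = W then 1 else 0)

/-- The variance of the number of packets cached by exactly the users in `W` is at most its mean. -/
lemma mdExpect_countCached_sub_sq_le (g : ℕ) (d : Fin K → Fin N) (k : Fin K)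
    {W : Finset (Fin K)} (hW : W.Nonempty) :
    mdExpect g d (fun S : Config K N (Packet F' L) =>
      ((countCached S (d k) W : ℝ) - F' * groupMean L g W) ^ 2) ≤ F' * groupMean L g W := by
  set p := groupMean L g W with hp
  -- Distinct groups are independent. On the diagonal `X * X ≤ X`, since a group count lies in `[0,
  -- 1]`.
  have hprod : ∀ i i' : Fin F', mdExpect g d (fun S : Config K N (Packet F' L) =>
      groupCount S (d k) W i * groupCount S (d k) W i') ≤ p * p + if i = i' then p else 0 := by
    intro i i'
    split_ifs with h
    · subst h
      have h1 : mdExpect g d (fun S : Config K N (Packet F' L) =>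
          groupCount S (d k) W i * groupCount S (d k) W i) ≤ p := by
        rw [hp, ← mdExpect_groupCount g d k W i]
        refine mdExpect_mono g d fun ω S hS => ?_
        have h0 : 0 ≤ groupCount S (d k) W i :=
          Finset.sum_nonneg fun l _ => by split_ifs <;> norm_num
        exact mul_le_of_le_one_left h0 (groupCount_le_one hS k hW i)
      nlinarith [mul_self_nonneg p]
    · rw [mdExpect_groupCount_mul_groupCount g d k W h, add_zero]
  have hexp : ∀ S : Config K N (Packet F' L),
      ((countCached S (d k) W : ℝ) - F' * p) ^ 2
        = (∑ i, ∑ i', groupCount S (d k) W i * groupCount S (d k) W i')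
          + ((-2 * F' * p) * (∑ i, groupCount S (d k) W i) + (F' * p) ^ 2) := by
    intro S
    rw [countCached_eq_sum_groupCount, ← Finset.sum_mul_sum]
    ring
  simp only [hexp]
  rw [mdExpect_add, mdExpect_add, mdExpect_const_mul, mdExpect_const, mdExpect_sum, mdExpect_sum]
  simp only [mdExpect_sum, mdExpect_groupCount, ← hp]
  have hs : ∑ i : Fin F', ∑ i' : Fin F', mdExpect g d (fun S : Config K N (Packet F' L) =>
      groupCount S (d k) W i * groupCount S (d k) W i') ≤ (F' * p) ^ 2 + F' * p := by
    refine (Finset.sum_le_sum fun i _ => Finset.sum_le_sum fun i' _ => hprod i i').trans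
      (le_of_eq ?_)
    simp [Finset.sum_add_distrib]
    ring
  simp only [Finset.sum_const, Finset.card_univ, Fintype.card_fin, nsmul_eq_mul]
  linarith

end SecondMoment

/-! ### From second moments to the expected rate -/

/-- At the maximizing index, `t ≤ s / 2 + t ^ 2 / (2 * s)` is applied to the deviation `t`, and the
square is bounded by the sum of all squares, whose expectation is available. -/
lemma cast_sup_le {α : Type*} (U : Finset α) (hU : U.Nonempty) (n : α → ℕ) (μ : α → ℝ)
    {m s : ℝ} (hs : 0 < s) (hμ : ∀ j ∈ U, μ j ≤ m) :
    ((U.sup n : ℕ) : ℝ) ≤ m + s / 2 + 1 / (2 * s) * ∑ j ∈ U, ((n j : ℝ) - μ j) ^ 2 := by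
  obtain ⟨j, hj, he⟩ := Finset.exists_mem_eq_sup U hU n
  rw [he]
  have h1 : ((n j : ℝ) - μ j) ^ 2 ≤ ∑ j ∈ U, ((n j : ℝ) - μ j) ^ 2 :=
    Finset.single_le_sum (f := fun j => ((n j : ℝ) - μ j) ^ 2) (fun _ _ => sq_nonneg _) hj
  have h2 : (n j : ℝ) - μ j ≤ s / 2 + 1 / (2 * s) * ((n j : ℝ) - μ j) ^ 2 := by
    have : 0 ≤ ((n j : ℝ) - μ j - s) ^ 2 / (2 * s) := by positivity
    have e : ((n j : ℝ) - μ j - s) ^ 2 / (2 * s)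
        = s / 2 + 1 / (2 * s) * ((n j : ℝ) - μ j) ^ 2 - ((n j : ℝ) - μ j) := by
      field_simp
      ring
    linarith
  have h3 : 1 / (2 * s) * ((n j : ℝ) - μ j) ^ 2
      ≤ 1 / (2 * s) * ∑ j ∈ U, ((n j : ℝ) - μ j) ^ 2 :=
    mul_le_mul_of_nonneg_left h1 (by positivity)
  linarith [hμ j hj]

lemma length_packetList (F' L : ℕ) : (packetList F' L).length = F' * L := by
  simp [packetList, List.length_product]

lemma mem_packetList {F' L : ℕ} (f : Packet F' L) : f ∈ packetList F' L :=
  List.mem_product.2 ⟨List.mem_finRange _, List.mem_finRange _⟩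

lemma expectedRate_le_users {K N F' L g : ℕ} (hL : 0 < L) (d : Fin K → Fin N) :
    expectedRate F' L g d ≤ K := by
  have : NeZero L := ⟨hL.ne'⟩
  refine Finset.expect_le Finset.univ_nonempty fun ω _ =>
    Finset.expect_le (pullDowns_nonempty _ _ _) fun S _ => ?_
  refine div_le_of_le_mul₀ (by positivity) (by positivity) ?_
  exact_mod_cast length_newDelivery_le_card (packetList F' L) S d

/-- The first summand pays for user sets of size `g + 1`, each with `g + 1` variances of at most
`m`; the second for packets in fewer than `g` caches. The scale `s` stays free, to be chosen
proportional to `m`. -/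
lemma expectedRate_mul_le {K N F' L g : ℕ} (hL : 0 < L) (hF : 0 < F') (hg : 0 < g)
    (d : Fin K → Fin N) {m s : ℝ} (hs : 0 < s) (hm : m = F' * L / (K.choose g : ℝ)) :
    expectedRate F' L g d * (F' * L) ≤
      (K.choose (g + 1) : ℝ) * (m + s / 2 + 1 / (2 * s) * ((g + 1) * m))
        + K * (F' * L) * (2 ^ g * (1 - 1 / (2 * (L : ℝ))) ^ K) := by
  have : NeZero L := ⟨hL.ne'⟩
  have hFL : ((F' : ℝ) * L) ≠ 0 := by positivity
  have hmean : ∀ W : Finset (Fin K), W.card = g → F' * groupMean L g W ≤ m := by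
    intro W hW
    rw [hm, mul_div_assoc]
    exact mul_le_mul_of_nonneg_left (groupMean_le g hW) (by positivity)
  have h1 : expectedRate F' L g d * (F' * L) = mdExpect g d
      (fun S => ((newDelivery (packetList F' L) S d).length : ℝ)) := by
    have : expectedRate F' L g d = mdExpect g d (fun S => ((F' : ℝ) * L)⁻¹ *
        ((newDelivery (packetList F' L) S d).length : ℝ)) := by
      unfold expectedRate expectedRateMD mdExpect rateND
      simp only [length_packetList, Nat.cast_mul, div_eq_inv_mul]
    rw [this, mdExpect_const_mul]
    field_simp
  rw [h1]
  have hcard : ∀ U ∈ (Finset.univ : Finset (Fin K)).powersetCard (g + 1), ∀ j ∈ U,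
      (U.erase j).card = g := fun U hU j hj => by
    rw [Finset.card_erase_of_mem hj, (Finset.mem_powersetCard.1 hU).2, Nat.add_sub_cancel]
  have h2 : mdExpect g d (fun S => ((newDelivery (packetList F' L) S d).length : ℝ))
      ≤ mdExpect g d (fun S => (∑ U ∈ Finset.univ.powersetCard (g + 1),
          (m + s / 2 + 1 / (2 * s) * ∑ j ∈ U, ((countCached S (d j) (U.erase j) : ℝ)
            - F' * groupMean L g (U.erase j)) ^ 2))
        + ∑ j : Fin K, ∑ i : Fin F', ∑ l : Fin L,
            if (S (d j) (i, l)).card < g then (1 : ℝ) else 0) := by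
    refine mdExpect_mono g d fun ω S hS => ?_
    have hlen := length_newDelivery_le (packetList F' L) mem_packetList S d g
      fun k f => card_le_of_mem_pulled (mem_pulled_of_mem_pullDowns hS k f)
    refine (Nat.cast_le (α := ℝ).2 hlen).trans ?_
    rw [Nat.cast_add, Nat.cast_sum, Nat.cast_sum]
    refine add_le_add (Finset.sum_le_sum fun U hU => ?_) (Finset.sum_le_sum fun j _ => le_of_eq ?_)
    · refine cast_sup_le U ?_ _ _ hs fun j hj => hmean _ (hcard U hU j hj)
      rw [← Finset.card_pos, (Finset.mem_powersetCard.1 hU).2]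
      omega
    · rw [Finset.card_filter, Nat.cast_sum, Fintype.sum_prod_type]
      simp only [Nat.cast_ite, Nat.cast_one, Nat.cast_zero]
  refine h2.trans ?_
  rw [mdExpect_add, mdExpect_sum]
  refine add_le_add ?_ ?_
  · have : ∀ U ∈ (Finset.univ : Finset (Fin K)).powersetCard (g + 1),
        mdExpect g d (fun S : Config K N (Packet F' L) =>
          m + s / 2 + 1 / (2 * s) * ∑ j ∈ U, ((countCached S (d j) (U.erase j) : ℝ)
            - F' * groupMean L g (U.erase j)) ^ 2)
          ≤ m + s / 2 + 1 / (2 * s) * ((g + 1) * m) := by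
      intro U hU
      rw [mdExpect_add, mdExpect_const, mdExpect_const_mul, mdExpect_sum]
      have hsum : ∑ j ∈ U, mdExpect g d (fun S : Config K N (Packet F' L) =>
          ((countCached S (d j) (U.erase j) : ℝ) - F' * groupMean L g (U.erase j)) ^ 2)
          ≤ (g + 1) * m := by
        refine (Finset.sum_le_card_nsmul U _ m fun j hj => ?_).trans (le_of_eq ?_)
        · have hc := hcard U hU j hj
          exact (mdExpect_countCached_sub_sq_le g d j (Finset.card_pos.1 (by omega))).trans
            (hmean _ hc)
        · rw [(Finset.mem_powersetCard.1 hU).2, nsmul_eq_mul]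
          push_cast
          ring
      gcongr
    refine (Finset.sum_le_sum this).trans (le_of_eq ?_)
    rw [Finset.sum_const, Finset.card_powersetCard, Finset.card_univ, Fintype.card_fin,
      nsmul_eq_mul]
  · simp only [mdExpect_sum]
    have : ∀ (j : Fin K) (i : Fin F') (l : Fin L),
        mdExpect g d (fun S : Config K N (Packet F' L) =>
          if (S (d j) (i, l)).card < g then (1 : ℝ) else 0)
          ≤ 2 ^ g * (1 - 1 / (2 * (L : ℝ))) ^ K := fun j i l =>
      (mdExpect_apply g d j i l fun A => if A.card < g then 1 else 0).le.trans
        (packetExpect_card_lt_le g l)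
    refine (Finset.sum_le_sum fun j _ => Finset.sum_le_sum fun i _ =>
      Finset.sum_le_sum fun l _ => this j i l).trans (le_of_eq ?_)
    simp
    ring

/-! ### Numerical estimates and choice of constants -/

lemma two_pow_le_choose {K g : ℕ} (h : 3 * g ≤ K) : 2 ^ g ≤ K.choose g := by
  have h1 := Nat.pow_le_choose (α := ℚ) g K
  rw [div_le_iff₀ (by positivity)] at h1
  have h2 : (K + 1 - g) ^ g ≤ K.choose g * g.factorial := by exact_mod_cast h1
  have h3 : (2 * g) ^ g ≤ (K + 1 - g) ^ g := Nat.pow_le_pow_left (by omega) g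
  have h4 : 2 ^ g * g.factorial ≤ (2 * g) ^ g := by
    rw [mul_pow]
    exact Nat.mul_le_mul_left _ (Nat.factorial_le_pow g)
  exact Nat.le_of_mul_le_mul_right (h4.trans (h3.trans h2)) g.factorial_pos

lemma le_choose {K g : ℕ} (hg : 0 < g) (hK : g < K) : K ≤ K.choose g := by
  obtain ⟨a, rfl⟩ : ∃ a, g = a + 1 := ⟨g - 1, by omega⟩
  obtain ⟨b, rfl⟩ : ∃ b, K = b + 1 := ⟨K - 1, by omega⟩
  have h : ∀ b a : ℕ, a < b → b + 1 ≤ (b + 1).choose (a + 1) := by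
    intro b
    induction b with
    | zero => intro a h; omega
    | succ b ih =>
      intro a hab
      rw [Nat.choose_succ_succ']
      rcases Nat.lt_or_ge a b with hlt | hge
      · have h1 := ih a hlt
        have h2 : 0 < (b + 1).choose a := Nat.choose_pos (by omega)
        omega
      · obtain rfl : a = b := by omega
        simp [Nat.choose_succ_self_right]
  exact h b a (by omega)

/-- With `x = K / L`, the factor `2 ^ g` is at most `exp (x / 4)` because `log 2 / 3 < 1 / 4`, while
the power is at most `exp (-x / 2)`. The remaining `exp (-x / 4)` beats the linear `12 * (g + 1)`.
-/
lemma tail_le {K L g : ℕ} (hL : 0 < L) (hg : (g : ℝ) ≤ K / (3 * L)) (hK : (160 : ℝ) ≤ K / L) :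
    2 ^ g * (1 - 1 / (2 * (L : ℝ))) ^ K ≤ 1 / (12 * ((g : ℝ) + 1)) := by
  have hL' : (1 : ℝ) ≤ L := by exact_mod_cast hL
  set x : ℝ := K / L with hx
  have hgx : (g : ℝ) ≤ x / 3 := by
    refine hg.trans (le_of_eq ?_)
    rw [hx]
    field_simp
  have h1 : (2 : ℝ) ^ g ≤ Real.exp (x / 4) := by
    rw [← Real.exp_log (by norm_num : (0 : ℝ) < 2), ← Real.exp_nat_mul]
    refine Real.exp_le_exp.2 ?_
    have := Real.log_two_lt_d9
    have := Real.log_pos (by norm_num : (1 : ℝ) < 2)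
    nlinarith
  have h0 : 0 ≤ 1 - 1 / (2 * (L : ℝ)) := by
    rw [sub_nonneg, div_le_one (by positivity)]
    linarith
  have h2 : (1 - 1 / (2 * (L : ℝ))) ^ K ≤ Real.exp (-(x / 2)) := by
    have hb : 1 - 1 / (2 * (L : ℝ)) ≤ Real.exp (-(1 / (2 * (L : ℝ)))) :=
      Real.one_sub_le_exp_neg _
    refine (pow_le_pow_left₀ h0 hb K).trans (le_of_eq ?_)
    rw [← Real.exp_nat_mul]
    congr 1
    rw [hx]
    field_simp
  -- It suffices that `4 * x + 12 ≤ 1 + x / 4 + x ^ 2 / 32`, which holds for `x ≥ 160`.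
  have h3 : 12 * ((g : ℝ) + 1) ≤ Real.exp (x / 4) := by
    have := Real.quadratic_le_exp_of_nonneg (x := x / 4) (by linarith)
    nlinarith
  calc _ ≤ Real.exp (x / 4) * Real.exp (-(x / 2)) :=
        mul_le_mul h1 h2 (pow_nonneg h0 K) (Real.exp_nonneg _)
    _ = 1 / Real.exp (x / 4) := by
        rw [← Real.exp_add, one_div, ← Real.exp_neg]
        congr 1
        ring
    _ ≤ _ := one_div_le_one_div_of_le (by positivity) h3

lemma expectedRate_le_of_large {c : ℝ} (hc : 0 < c) {K N F' L g : ℕ} (hL : 0 < L) (hg2 : 2 ≤ g)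
    (hg : (g : ℝ) ≤ K / (3 * L)) (hLK : (L : ℝ) ≤ K / (27 / 4 * Real.log K))
    (hK : 24 ≤ Real.log K) (hKc : 54 / c ≤ Real.log K)
    (hF : c * ((K.choose g : ℝ) * Real.log (K.choose g : ℝ) ^ 2) ≤ F') (d : Fin K → Fin N) :
    expectedRate F' L g d ≤ 4 / 3 * ((K : ℝ) / ((g : ℝ) + 1)) := by
  have hL' : (1 : ℝ) ≤ L := by exact_mod_cast hL
  have hgK : (g : ℝ) * (3 * L) ≤ K := (le_div_iff₀ (by positivity)).1 hg
  have hg2' : (2 : ℝ) ≤ g := by exact_mod_cast hg2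
  have h3g : 3 * g ≤ K := by
    have : (3 : ℝ) * g ≤ K := by nlinarith
    exact_mod_cast this
  -- `27 / 4 * 24 = 162`.
  have hx : (160 : ℝ) ≤ K / L := by
    rw [le_div_iff₀ (by positivity)] at hLK ⊢
    nlinarith
  have hK0 : (0 : ℝ) < K := by
    have : 0 < K := by omega
    exact_mod_cast this
  have hB : 0 < K.choose g := Nat.choose_pos (by omega)
  set B : ℝ := (K.choose g : ℝ) with hBdef
  have hB' : 0 < B := Nat.cast_pos.2 hB
  have hlogK : Real.log K ≤ Real.log B :=
    Real.log_le_log hK0 (Nat.cast_le.2 (le_choose (by omega) (by omega)))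
  have hlogg : (g : ℝ) / 2 ≤ Real.log B := by
    have h1 : Real.log ((2 : ℝ) ^ g) ≤ Real.log B :=
      Real.log_le_log (by positivity) (by
        rw [hBdef]
        exact_mod_cast two_pow_le_choose h3g)
    rw [Real.log_pow] at h1
    have := Real.log_two_gt_d9
    nlinarith
  have hclog : 18 * ((g : ℝ) + 1) ≤ c * Real.log B ^ 2 := by
    have h1 : 54 ≤ c * Real.log B := by
      rw [div_le_iff₀ hc] at hKc
      nlinarith
    -- `(g + 1) / 3 ≤ g / 2` is exactly `2 ≤ g`.
    have h2 : ((g : ℝ) + 1) / 3 ≤ Real.log B := by linarith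
    calc 18 * ((g : ℝ) + 1) = 54 * (((g : ℝ) + 1) / 3) := by ring
      _ ≤ (c * Real.log B) * Real.log B := by gcongr
      _ = _ := by ring
  have hF0 : (0 : ℝ) < F' := by
    refine lt_of_lt_of_le ?_ hF
    have : 0 < c * Real.log B ^ 2 := by linarith
    nlinarith
  set m : ℝ := F' * L / B with hm
  have hmg : 18 * ((g : ℝ) + 1) ≤ m := by
    rw [hm, le_div_iff₀ hB']
    nlinarith
  have hm0 : 0 < m := by linarith
  -- With `s = m / 3` the bracket is `m + m / 6 + 3 / 2 * (g + 1)`. By `hmg` the last term is at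
  -- most `m / 12`, giving `5 / 4 * m`.
  have key := expectedRate_mul_le hL (by exact_mod_cast hF0) (by omega) d
    (s := m / 3) (by positivity) hm
  have hcs : (K.choose (g + 1) : ℝ) * ((g : ℝ) + 1) ≤ B * K := by
    have h1 := Nat.choose_succ_right_eq K g
    have h2 : K.choose g * (K - g) ≤ K.choose g * K := Nat.mul_le_mul_left _ (by omega)
    rw [← h1] at h2
    rw [hBdef]
    exact_mod_cast h2
  have hFL : 0 < (F' : ℝ) * L := by positivity
  have hmB : m * B = F' * L := by
    rw [hm]
    field_simp
  have hmid : m + m / 3 / 2 + 1 / (2 * (m / 3)) * ((g + 1) * m) ≤ 5 / 4 * m := by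
    have : 1 / (2 * (m / 3)) * (((g : ℝ) + 1) * m) = 3 / 2 * ((g : ℝ) + 1) := by
      field_simp
    rw [this]
    linarith
  have hfirst : (K.choose (g + 1) : ℝ) * (m + m / 3 / 2 + 1 / (2 * (m / 3)) * ((g + 1) * m))
      ≤ 5 / 4 * (K / ((g : ℝ) + 1)) * (F' * L) := by
    calc _ ≤ (K.choose (g + 1) : ℝ) * (5 / 4 * m) := by gcongr
      _ ≤ (B * K / ((g : ℝ) + 1)) * (5 / 4 * m) := by
          gcongr
          rwa [le_div_iff₀ (by positivity)]
      _ = 5 / 4 * (K / ((g : ℝ) + 1)) * (m * B) := by ring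
      _ = _ := by rw [hmB]
  have hsecond : K * (F' * L) * (2 ^ g * (1 - 1 / (2 * (L : ℝ))) ^ K)
      ≤ 1 / 12 * (K / ((g : ℝ) + 1)) * (F' * L) := by
    calc _ ≤ K * (F' * L) * (1 / (12 * ((g : ℝ) + 1))) := by
          gcongr
          exact tail_le hL hg hx
      _ = _ := by
          field_simp
  refine le_of_mul_le_mul_right ?_ hFL
  linarith

/-- Rounding `c * A` up costs at most `1 ≤ A`, since `K.choose g ≥ 4 > e`. -/
lemma exists_group_count {c : ℝ} (hc : 0 < c) {K g : ℕ} (hg : 2 ≤ g) (hgK : 3 * g ≤ K) (L : ℕ) :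
    ∃ F' : ℕ, 0 < F' ∧
      c * ((K.choose g : ℝ) * Real.log (K.choose g : ℝ) ^ 2) ≤ (F' : ℝ) ∧
      ((L * F' : ℕ) : ℝ)
        ≤ (c + 1) * ((K.choose g : ℝ) * Real.log (K.choose g : ℝ) ^ 2 * (L : ℝ)) := by
  have hB : (4 : ℝ) ≤ (K.choose g : ℝ) := by
    have h1 := two_pow_le_choose hgK
    have h2 : 2 ^ 2 ≤ 2 ^ g := Nat.pow_le_pow_right (by norm_num) hg
    have h3 : 4 ≤ K.choose g := by omega
    exact_mod_cast h3
  have hlog : 1 ≤ Real.log (K.choose g : ℝ) := by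
    rw [Real.le_log_iff_exp_le (by linarith)]
    linarith [Real.exp_one_lt_d9]
  set A : ℝ := (K.choose g : ℝ) * Real.log (K.choose g : ℝ) ^ 2 with hA
  have hA1 : 1 ≤ A := by nlinarith
  refine ⟨⌈c * A⌉₊, Nat.ceil_pos.2 (by positivity), Nat.le_ceil _, ?_⟩
  have h := Nat.ceil_lt_add_one (show 0 ≤ c * A by positivity)
  push_cast
  calc (L : ℝ) * (⌈c * A⌉₊ : ℝ) ≤ L * ((c + 1) * A) := by
        gcongr
        linarith
    _ = _ := by ring

end CodedCaching

theorem theorem7 (c : ℝ) (hc : 0 < c) :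
    ∃ ε : ℕ → ℝ, Filter.Tendsto ε Filter.atTop (nhds 0) ∧
      ∀ (K N g : ℕ) (M : ℝ), 0 < M → K < N → 2 ≤ g →
        (g : ℝ) ≤ (K : ℝ) / (3 * (CodedCaching.groupSize N M : ℝ)) →
        (CodedCaching.groupSize N M : ℝ) ≤ (K : ℝ) / (27 / 4 * Real.log (K : ℝ)) →
        (∀ F' : ℕ,
          c * ((K.choose g : ℝ) * Real.log (K.choose g : ℝ) ^ 2) ≤ (F' : ℝ) →
          ∀ d : Fin K → Fin N,
            CodedCaching.expectedRate F' (CodedCaching.groupSize N M) g d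
              ≤ 4 / 3 * ((K : ℝ) / ((g : ℝ) + 1)) * (1 + ε K)) ∧
        ∃ F' : ℕ, 0 < F' ∧
          c * ((K.choose g : ℝ) * Real.log (K.choose g : ℝ) ^ 2) ≤ (F' : ℝ) ∧
          ((CodedCaching.groupSize N M * F' : ℕ) : ℝ)
            ≤ (c + 1) * ((K.choose g : ℝ) * Real.log (K.choose g : ℝ) ^ 2
                * (CodedCaching.groupSize N M : ℝ)) := by
  -- The threshold depends on `c` only. Below it, `ε K = K` makes the claim follow from the trivial
  -- rate bound `K`, because `g + 1 ≤ K + 1`.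
  refine ⟨fun K => if max 24 (54 / c) ≤ Real.log K then 0 else K, ?_, ?_⟩
  · refine tendsto_const_nhds.congr' ?_
    filter_upwards [(Real.tendsto_log_atTop.comp tendsto_natCast_atTop_atTop).eventually_ge_atTop
      (max 24 (54 / c))] with K hK
    exact (if_pos hK).symm
  · intro K N g M hM hKN hg hgK hLK
    have hL : 0 < CodedCaching.groupSize N M := by
      have : (0 : ℝ) < N := by exact_mod_cast (Nat.zero_le K).trans_lt hKN
      exact Nat.ceil_pos.2 (by positivity)
    have h3g : 3 * g ≤ K := by
      have hL' : (1 : ℝ) ≤ (CodedCaching.groupSize N M : ℝ) := by exact_mod_cast hL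
      have h1 := (le_div_iff₀ (by positivity)).1 hgK
      have h2 : (0 : ℝ) ≤ g := by positivity
      have : (3 : ℝ) * g ≤ K := by nlinarith
      exact_mod_cast this
    refine ⟨fun F' hF d => ?_, CodedCaching.exists_group_count hc hg h3g _⟩
    dsimp only
    split_ifs with hK
    · rw [add_zero, mul_one]
      exact CodedCaching.expectedRate_le_of_large hc hL hg hgK hLK ((le_max_left _ _).trans hK)
        ((le_max_right _ _).trans hK) hF d
    · refine (CodedCaching.expectedRate_le_users hL d).trans ?_
      have hgK' : (g : ℝ) ≤ K := by exact_mod_cast (show g ≤ K by omega)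
      rw [← mul_div_assoc, div_mul_eq_mul_div, le_div_iff₀ (by positivity)]
      have h0 : (0 : ℝ) ≤ K := by positivity
      nlinarith [mul_nonneg h0 h0]
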